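/- **Setting.** Let $\Omega\subset\mathbb R^n$ be a bounded open set with Lipschitz boundary, $\Gamma\subset\partial\Omega$ a measurable set, and $T>0$. All function spaces are real. - $H^1(\Omega)$ and $H^2(\Omega)=\{u\in L^2(\Omega):\nabla u\in (H^1(\Omega))^n\}$ carry their usual Hilbert norms. The gradient is the bounded operator $\nabla:H^2(\Omega)\to(H^1(\Omega))^n$. - For measurable $\Gamma'\subset\partial\Omega$, $H^{1/2}(\Gamma')$ is the Hilbert space of the traces on $\Gamma'$ of the functions of $H^1(\Omega)$, with the norm $\|g\|=\inf\{\|u\|_{H^1(\Omega)}: u|_{\Gamma'}=g\}$. $\gamma:(H^1(\Omega))^n\to(H^{1/2}(\partial\Omega))^n$ is the (componentwise) trace operator and $\chi_\Gamma:(H^{1/2}(\partial\Omega))^n\to(H^{1/2}(\Gamma))^n$ is the restriction operator. - $X$ is a Hilbert space that is continuously embedded in $L^2(\Omega)$ (the state space). The differential operator is $A=\sum_{i,j}\frac{\partial}{\partial\xi_i}\big(a_{ij}\frac{\partial}{\partial\xi_j}\big)$ with $a_{ij}\in C^\infty(\overline\Omega)$ and, for some $\alpha>0$, $\sum_{i,j}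 a_{ij}(\xi)\zeta_i\zeta_j\ge\alpha|\zeta|^2$ for almost every $\xi\in\Omega$ and all $\zeta\in\mathbb R^n$. Its realization in $X$ with Dirichlet boundary condition, whose domain is $\{x\in X\cap H^1_0(\Omega): Ax\in X\}$, is self-adjoint with compact resolvent and generates a strongly continuous semigroup $(S_A(t))_{t\ge0}$ on $X$. Let $C\in\mathcal L(X,\mathbb R^q)$. - The observed system is $\partial x/\partial t=Ax$ in $\Omega\times(0,T)$, $x(\cdot,0)=x_0$ in $\Omega$, $x=0$ on $\partial\Omega\times(0,T)$, with solution $x(t)=S_A(t)x_0$ and output $y(t)=Cx(t)$. Let $\mathcal O=L^2(0,T;\mathbb R^q)$ and let $K:X\to\mathcal O$, $Kx=CS_A(\cdot)x$, with adjoint $K^*:\mathcal O\to X$. Assume that $K^*y\in H^2(\Omega)$ for every $y\in\mathcal O$, so that $\nabla K^*$ takes values in $(H^1(\Omega))^n$ and $H=\chi_\Gamma\gamma\nabla K^*$ is defined from $\mathcal O$ into $(H^{1/2}(\Gamma))^n$. In $K\nabla^*\gamma^*\chi_\Gamma^*$, the operators $\nabla^*:(H^1(\Omega))^n\to H^2(\Omega)$,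 $\gamma^*$, $\chi_\Gamma^*$ are the Hilbert space adjoints, and $K$ stands for its extension by duality, the adjoint $H^2(\Omega)\to\mathcal O$ of $K^*:\mathcal O\to H^2(\Omega)$. (If $X$ is continuously embedded in $H^2(\Omega)$, then $K\nabla^*$ is the composition of $K:X\to\mathcal O$ with the adjoint of $\nabla:X\to(H^1(\Omega))^n$.) The system is *exactly $\Gamma_G$-observable* if $\operatorname{Im}H=(H^{1/2}(\Gamma))^n$. **Proposition.** The system is exactly $\Gamma_G$-observable if and only if there exists $c>0$ such that $$\|x^*\|_{(H^{1/2}(\Gamma))^n}\le c\,\|K\nabla^*\gamma^*\chi_\Gamma^*x^*\|_{\mathcal O}\qquad\text{for all }x^*\in(H^{1/2}(\Gamma))^n .$$ -/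

import Mathlib

open MeasureTheory Filter Topology Set
open scoped NNReal ENNReal ContDiff InnerProductSpace

noncomputable section

namespace GradObs

/-! ### Sobolev spaces on an open set of `ℝⁿ` -/

/-- `ℝⁿ` with its Euclidean norm. -/
abbrev E (n : ℕ) := EuclideanSpace ℝ (Fin n)

/-- The real Hilbert space `L²(Ω)`. -/
abbrev L2 {n : ℕ} (Ω : Set (E n)) := Lp ℝ 2 (volume.restrict Ω)

/-- Test functions `φ ∈ C_c^∞(Ω)`. -/
structure IsTest {n : ℕ} (Ω : Set (E n)) (φ : E n → ℝ) : Prop where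
  smooth : ContDiff ℝ ∞ φ
  compact : HasCompactSupport φ
  support : tsupport φ ⊆ Ω

/-- The classical partial derivative `∂φ/∂ξ_i` at `ξ`. -/
def pd {n : ℕ} (i : Fin n) (φ : E n → ℝ) (ξ : E n) : ℝ :=
  fderiv ℝ φ ξ (EuclideanSpace.single i 1)

/-- `v ∈ L²(Ω)` is the weak partial derivative `∂u/∂ξ_i` of `u ∈ L²(Ω)`. -/
def IsWeakPartial {n : ℕ} (Ω : Set (E n)) (i : Fin n) (u v : L2 Ω) : Prop :=
  ∀ φ, IsTest Ω φ → ∫ ξ in Ω, u ξ * pd i φ ξ = - ∫ ξ in Ω, v ξ * φ ξ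

theorem IsTest.memLp {n : ℕ} {Ω : Set (E n)} {φ : E n → ℝ} (h : IsTest Ω φ) :
    MemLp φ 2 (volume.restrict Ω) :=
  (h.smooth.continuous.memLp_of_hasCompactSupport h.compact).restrict Ω

theorem IsTest.memLp_pd {n : ℕ} {Ω : Set (E n)} {φ : E n → ℝ} (h : IsTest Ω φ) (i : Fin n) :
    MemLp (pd i φ) 2 (volume.restrict Ω) := by
  have hc : Continuous (pd i φ) := by
    have := h.smooth.continuous_fderiv (by simp)
    unfold pd
    fun_prop
  have hs : HasCompactSupport (pd i φ) := h.compact.fderiv_apply (𝕜 := ℝ) _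
  exact (hc.memLp_of_hasCompactSupport hs).restrict Ω

theorem integral_mul_eq_inner {n : ℕ} {Ω : Set (E n)} {ψ : E n → ℝ}
    (hψ : MemLp ψ 2 (volume.restrict Ω)) (u : L2 Ω) :
    ∫ ξ in Ω, u ξ * ψ ξ = ⟪hψ.toLp ψ, u⟫_ℝ := by
  rw [L2.inner_def]
  refine integral_congr_ae ?_
  filter_upwards [hψ.coeFn_toLp] with ξ hξ
  simp [hξ]

theorem isWeakPartial_iff {n : ℕ} {Ω : Set (E n)} {i : Fin n} {u v : L2 Ω} :
    IsWeakPartial Ω i u v ↔ ∀ φ, ∀ h : IsTest Ω φ,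
      ⟪(h.memLp_pd i).toLp _, u⟫_ℝ + ⟪h.memLp.toLp _, v⟫_ℝ = 0 := by
  refine forall₂_congr fun φ h => ?_
  rw [integral_mul_eq_inner (h.memLp_pd i), integral_mul_eq_inner h.memLp, eq_neg_iff_add_eq_zero]

/-- `H¹(Ω)` as the subspace of those pairs `(u, g)` in the Hilbert space `L²(Ω) × L²(Ω)ⁿ` for which
`g` is the weak gradient of `u`. The induced norm is
`‖u‖²_{H¹} = ‖u‖²_{L²} + ∑ᵢ ‖∂u/∂ξ_i‖²_{L²}`. -/
def h1 {n : ℕ} (Ω : Set (E n)) :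
    Submodule ℝ (WithLp 2 (L2 Ω × PiLp 2 (fun _ : Fin n => L2 Ω))) where
  carrier := {w | ∀ i, IsWeakPartial Ω i w.fst (w.snd i)}
  zero_mem' i := by
    rw [isWeakPartial_iff]; intro φ h; simp
  add_mem' {a b} ha hb i := by
    rw [isWeakPartial_iff]; intro φ h
    have h1 := isWeakPartial_iff.1 (ha i) φ h
    have h2 := isWeakPartial_iff.1 (hb i) φ h
    simp only [WithLp.add_fst, WithLp.add_snd, PiLp.add_apply, inner_add_right]
    linarith
  smul_mem' c a ha i := by
    rw [isWeakPartial_iff]; intro φ h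
    have h1 := isWeakPartial_iff.1 (ha i) φ h
    simp only [WithLp.smul_fst, WithLp.smul_snd, PiLp.smul_apply, inner_smul_right]
    rw [← mul_add, h1, mul_zero]

theorem isClosed_h1 {n : ℕ} (Ω : Set (E n)) : 
    IsClosed (h1 Ω : Set (WithLp 2 (L2 Ω × PiLp 2 (fun _ : Fin n => L2 Ω)))) := by
  have : (h1 Ω : Set (WithLp 2 (L2 Ω × PiLp 2 (fun _ : Fin n => L2 Ω)))) =
      ⋂ (i : Fin n), ⋂ (φ : E n → ℝ), ⋂ (h : IsTest Ω φ),
        {w | ⟪(h.memLp_pd i).toLp _, w.fst⟫_ℝ + ⟪h.memLp.toLp _, w.snd i⟫_ℝ = 0} := by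
    ext w
    simp only [mem_iInter, mem_ofPred_eq]
    exact forall_congr' fun i => isWeakPartial_iff
  rw [this]
  refine isClosed_iInter fun i => isClosed_iInter fun φ => isClosed_iInter fun h => ?_
  refine isClosed_eq ?_ continuous_const
  have c1 : Continuous fun w : WithLp 2 (L2 Ω × PiLp 2 (fun _ : Fin n => L2 Ω)) => w.fst :=
    (WithLp.fstL 2 ℝ _ _).continuous
  have c2 : Continuous fun w : WithLp 2 (L2 Ω × PiLp 2 (fun _ : Fin n => L2 Ω)) => w.snd i :=
    (PiLp.proj (𝕜 := ℝ) 2 (fun _ : Fin n => L2 Ω) i).continuous.comp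
      (WithLp.sndL 2 ℝ _ _).continuous
  exact (continuous_const.inner c1).add (continuous_const.inner c2)

/-- The Hilbert space `H¹(Ω)`. -/
def H1 {n : ℕ} (Ω : Set (E n)) : Type := h1 Ω

instance {n : ℕ} (Ω : Set (E n)) : NormedAddCommGroup (H1 Ω) :=
  inferInstanceAs (NormedAddCommGroup (h1 Ω))

instance {n : ℕ} (Ω : Set (E n)) : InnerProductSpace ℝ (H1 Ω) :=
  inferInstanceAs (InnerProductSpace ℝ (h1 Ω))

instance {n : ℕ} (Ω : Set (E n)) : CompleteSpace (H1 Ω) :=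
  (isClosed_h1 Ω).completeSpace_coe

/-- The inclusion `H¹(Ω) → L²(Ω)`. -/
def H1.toL2 {n : ℕ} (Ω : Set (E n)) : H1 Ω →L[ℝ] L2 Ω :=
  (WithLp.fstL 2 ℝ (L2 Ω) (PiLp 2 (fun _ : Fin n => L2 Ω))).comp (h1 Ω).subtypeL

/-- The weak partial derivative `∂/∂ξ_i : H¹(Ω) → L²(Ω)`. -/
def H1.partialL {n : ℕ} (Ω : Set (E n)) (i : Fin n) : H1 Ω →L[ℝ] L2 Ω :=
  (PiLp.proj (𝕜 := ℝ) 2 (fun _ : Fin n => L2 Ω) i).comp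
    ((WithLp.sndL 2 ℝ (L2 Ω) (PiLp 2 (fun _ : Fin n => L2 Ω))).comp (h1 Ω).subtypeL)

/-- `H¹₀(Ω)`: the closure of `C_c^∞(Ω)` in `H¹(Ω)`. -/
def H10 {n : ℕ} (Ω : Set (E n)) : Set (H1 Ω) :=
  closure {w | ∃ φ, IsTest Ω φ ∧ H1.toL2 Ω w =ᵐ[volume.restrict Ω] φ}

/-- The Hilbert space `(H¹(Ω))ⁿ`. -/
abbrev H1Vec {n : ℕ} (Ω : Set (E n)) := PiLp 2 (fun _ : Fin n => H1 Ω)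

/-- `H²(Ω)`, the functions of `L²(Ω)` whose weak gradient lies in `(H¹(Ω))ⁿ`, as the subspace of the
pairs `(u, ∇u)` in `L²(Ω) × (H¹(Ω))ⁿ`. The induced norm is
`‖u‖²_{H²} = ‖u‖²_{L²} + ∑ᵢ ‖∂u/∂ξ_i‖²_{L²} + ∑ᵢⱼ ‖∂²u/∂ξ_j∂ξ_i‖²_{L²}`. -/
def h2 {n : ℕ} (Ω : Set (E n)) : Submodule ℝ (WithLp 2 (L2 Ω × H1Vec Ω)) where
  carrier := {w | ∀ i, IsWeakPartial Ω i w.fst (H1.toL2 Ω (w.snd i))}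
  zero_mem' i := by
    rw [isWeakPartial_iff]; intro φ h; simp
  add_mem' {a b} ha hb i := by
    rw [isWeakPartial_iff]; intro φ h
    have h1 := isWeakPartial_iff.1 (ha i) φ h
    have h2 := isWeakPartial_iff.1 (hb i) φ h
    simp only [WithLp.add_fst, WithLp.add_snd, PiLp.add_apply, inner_add_right, map_add]
    linarith
  smul_mem' c a ha i := by
    rw [isWeakPartial_iff]; intro φ h
    have h1 := isWeakPartial_iff.1 (ha i) φ h
    simp only [WithLp.smul_fst, WithLp.smul_snd, PiLp.smul_apply, inner_smul_right, map_smul]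
    rw [← mul_add, h1, mul_zero]

theorem isClosed_h2 {n : ℕ} (Ω : Set (E n)) : 
    IsClosed (h2 Ω : Set (WithLp 2 (L2 Ω × H1Vec Ω))) := by
  have : (h2 Ω : Set (WithLp 2 (L2 Ω × H1Vec Ω))) =
      ⋂ (i : Fin n), ⋂ (φ : E n → ℝ), ⋂ (h : IsTest Ω φ),
        {w | ⟪(h.memLp_pd i).toLp _, w.fst⟫_ℝ + ⟪h.memLp.toLp _, H1.toL2 Ω (w.snd i)⟫_ℝ = 0} := by
    ext w
    simp only [mem_iInter, mem_ofPred_eq]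
    exact forall_congr' fun i => isWeakPartial_iff
  rw [this]
  refine isClosed_iInter fun i => isClosed_iInter fun φ => isClosed_iInter fun h => ?_
  refine isClosed_eq ?_ continuous_const
  have c1 : Continuous fun w : WithLp 2 (L2 Ω × H1Vec Ω) => w.fst :=
    (WithLp.fstL 2 ℝ _ _).continuous
  have c2 : Continuous fun w : WithLp 2 (L2 Ω × H1Vec Ω) => H1.toL2 Ω (w.snd i) :=
    (H1.toL2 Ω).continuous.comp ((PiLp.proj (𝕜 := ℝ) 2 (fun _ : Fin n => H1 Ω) i).continuous.comp
      (WithLp.sndL 2 ℝ _ _).continuous)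
  exact (continuous_const.inner c1).add (continuous_const.inner c2)

/-- The Hilbert space `H²(Ω)`. -/
def H2 {n : ℕ} (Ω : Set (E n)) : Type := h2 Ω

instance {n : ℕ} (Ω : Set (E n)) : NormedAddCommGroup (H2 Ω) :=
  inferInstanceAs (NormedAddCommGroup (h2 Ω))

instance {n : ℕ} (Ω : Set (E n)) : InnerProductSpace ℝ (H2 Ω) :=
  inferInstanceAs (InnerProductSpace ℝ (h2 Ω))

instance {n : ℕ} (Ω : Set (E n)) : CompleteSpace (H2 Ω) :=
  (isClosed_h2 Ω).completeSpace_coe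

/-- The inclusion `H²(Ω) → L²(Ω)`. -/
def H2.toL2 {n : ℕ} (Ω : Set (E n)) : H2 Ω →L[ℝ] L2 Ω :=
  (WithLp.fstL 2 ℝ (L2 Ω) (H1Vec Ω)).comp (h2 Ω).subtypeL

/-- The gradient `∇ : u ↦ (∂u/∂ξ_1, …, ∂u/∂ξ_n)` with values in `(H¹(Ω))ⁿ`, on its natural domain
`H²(Ω) = {u : ∇u ∈ (H¹(Ω))ⁿ}`. -/
def grad {n : ℕ} (Ω : Set (E n)) : H2 Ω →L[ℝ] H1Vec Ω :=
  (WithLp.sndL 2 ℝ (L2 Ω) (H1Vec Ω)).comp (h2 Ω).subtypeL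

/-- An `L²` function has at most one weak derivative, so that the inclusion of `H¹` in `L²` is
injective. -/
theorem IsWeakPartial.unique {n : ℕ} {Ω : Set (E n)} (hΩ : IsOpen Ω) {i : Fin n} {u v v' : L2 Ω}
    (h : IsWeakPartial Ω i u v) (h' : IsWeakPartial Ω i u v') : v = v' := by
  have key : ∀ φ : E n → ℝ, ContDiff ℝ ∞ φ → HasCompactSupport φ → tsupport φ ⊆ Ω →
      ∫ ξ, φ ξ • ((v - v' : L2 Ω) : E n → ℝ) ξ ∂(volume.restrict Ω) = 0 := by
    intro φ h1 h2 h3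
    have ht : IsTest Ω φ := ⟨h1, h2, h3⟩
    have e1 := isWeakPartial_iff.1 h φ ht
    have e2 := isWeakPartial_iff.1 h' φ ht
    have e3 := integral_mul_eq_inner ht.memLp (v - v')
    rw [inner_sub_right] at e3
    have : ∫ ξ, φ ξ • ((v - v' : L2 Ω) : E n → ℝ) ξ ∂(volume.restrict Ω)
        = ∫ ξ in Ω, ((v - v' : L2 Ω) : E n → ℝ) ξ * φ ξ := by
      simp only [smul_eq_mul, mul_comm]
    rw [this, e3]; linarith
  have hloc : LocallyIntegrableOn ((v - v' : L2 Ω) : E n → ℝ) Ω volume := by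
    have hl : LocallyIntegrable ((v - v' : L2 Ω) : E n → ℝ) (volume.restrict Ω) :=
      (Lp.memLp (v - v')).locallyIntegrable (by norm_num)
    rw [locallyIntegrableOn_iff hΩ.isLocallyClosed]
    intro k hk hkc
    have := hl.integrableOn_isCompact hkc
    rwa [IntegrableOn, Measure.restrict_restrict hkc.measurableSet,
      inter_eq_self_of_subset_left hk] at this
  have hz := hΩ.ae_eq_zero_of_integral_contDiff_smul_eq_zero hloc (fun φ h1 h2 h3 => by
    rw [← key φ h1 h2 h3]
    refine (setIntegral_eq_integral_of_forall_compl_eq_zero fun ξ hξ => ?_).symm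
    rw [image_eq_zero_of_notMem_tsupport (fun hx => hξ (h3 hx)), zero_smul])
  have : v - v' = 0 := by
    apply Lp.ext
    have hz' : ∀ᵐ ξ ∂(volume.restrict Ω), ((v - v' : L2 Ω) : E n → ℝ) ξ = 0 :=
      (ae_restrict_iff' hΩ.measurableSet).2 hz
    filter_upwards [hz', Lp.coeFn_zero ℝ 2 (volume.restrict Ω)] with ξ h1 h2
    rw [h1, h2]; rfl
  exact sub_eq_zero.1 this

theorem H1.toL2_injective {n : ℕ} {Ω : Set (E n)} (hΩ : IsOpen Ω) :
    Function.Injective (H1.toL2 Ω) := by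
  intro w w' h
  have h0 : w.1.fst = w'.1.fst := h
  have h1 : w.1.snd = w'.1.snd := by
    ext1 i
    have a := w.2 i
    rw [h0] at a
    exact a.unique hΩ (w'.2 i)
  apply Subtype.ext
  apply (WithLp.equiv 2 _).injective
  exact Prod.ext h0 h1

theorem H2.toL2_injective {n : ℕ} {Ω : Set (E n)} (hΩ : IsOpen Ω) :
    Function.Injective (H2.toL2 Ω) := by
  intro w w' h
  have h0 : w.1.fst = w'.1.fst := h
  have h1 : w.1.snd = w'.1.snd := by
    ext1 i
    have a := w.2 i
    rw [h0] at a
    exact H1.toL2_injective hΩ (a.unique hΩ (w'.2 i))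
  apply Subtype.ext
  apply (WithLp.equiv 2 _).injective
  exact Prod.ext h0 h1

/-! ### Boundary, traces, and the trace spaces `H^{1/2}` -/

/-- `Ω` has a Lipschitz boundary: near every boundary point `p`, for some unit direction `e` and
some Lipschitz function `ψ` of the coordinates orthogonal to `e`, the set `Ω` is
`{y : ψ(y) < ⟨e, y⟩}`. -/
def HasLipschitzBoundary {n : ℕ} (Ω : Set (E n)) : Prop :=
  ∀ p ∈ frontier Ω, ∃ (e : E n) (ψ : E n → ℝ) (L : ℝ≥0) (r : ℝ), ‖e‖ = 1 ∧ 0 < r ∧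
    LipschitzWith L ψ ∧ (∀ (y : E n) (s : ℝ), ψ (y + s • e) = ψ y) ∧
    Ω ∩ Metric.ball p r = {y | ψ y < ⟪e, y⟫_ℝ} ∩ Metric.ball p r

/-- The `(n-1)`-dimensional surface (Hausdorff) measure on `ℝⁿ`. -/
def surf (n : ℕ) : Measure (E n) := Measure.hausdorffMeasure ((n : ℝ) - 1)

/-- The trace on `Γ ⊆ ∂Ω` of `u ∈ H¹(Ω)` is `g`: functions that are smooth up to the boundary
approximate `u` in `H¹(Ω)` while their restrictions to `Γ` approximate `g` in `L²(Γ)`. -/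
def IsTrace {n : ℕ} (Ω Γ : Set (E n)) (u : H1 Ω) (g : E n → ℝ) : Prop :=
  ∀ ε : ℝ, 0 < ε → ∃ (φ : E n → ℝ) (w : H1 Ω), ContDiff ℝ ∞ φ ∧
    H1.toL2 Ω w =ᵐ[volume.restrict Ω] φ ∧ ‖w - u‖ < ε ∧
    eLpNorm (fun η => φ η - g η) 2 ((surf n).restrict Γ) < ENNReal.ofReal ε

/-- The functions of `H¹(Ω)` whose trace on `Γ` is zero. -/
def traceKer {n : ℕ} (Ω Γ : Set (E n)) : Submodule ℝ (H1 Ω) where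
  carrier := {u | IsTrace Ω Γ u 0}
  zero_mem' ε hε := by
    refine ⟨0, 0, contDiff_const, ?_, by simpa using hε, by simpa using hε⟩
    exact Lp.coeFn_zero ℝ 2 (volume.restrict Ω)
  add_mem' {u v} hu hv ε hε := by
    obtain ⟨φ, w, h1, h2, h3, h4⟩ := hu (ε / 2) (half_pos hε)
    obtain ⟨φ', w', h1', h2', h3', h4'⟩ := hv (ε / 2) (half_pos hε)
    refine ⟨φ + φ', w + w', h1.add h1', ?_, ?_, ?_⟩
    · exact (Lp.coeFn_add (H1.toL2 Ω w) (H1.toL2 Ω w')).trans (h2.add h2')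
    · calc ‖w + w' - (u + v)‖ = ‖(w - u) + (w' - v)‖ := by congr 1; abel
        _ ≤ ‖w - u‖ + ‖w' - v‖ := norm_add_le _ _
        _ < ε := by linarith
    · have e : (fun η => (φ + φ') η - (0 : E n → ℝ) η) =
          (fun η => φ η - (0 : E n → ℝ) η) + (fun η => φ' η - (0 : E n → ℝ) η) := by
        funext η; simp
      rw [e]
      refine (eLpNorm_add_le ?_ ?_ (by norm_num)).trans_lt ?_
      · exact (h1.continuous.sub continuous_const).aestronglyMeasurable
      · exact (h1'.continuous.sub continuous_const).aestronglyMeasurable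
      · refine (ENNReal.add_lt_add h4 h4').trans_eq ?_
        rw [← ENNReal.ofReal_add (by positivity) (by positivity)]; congr 1; ring
  smul_mem' c u hu ε hε := by
    have hc : 0 < ‖c‖ + 1 := by positivity
    obtain ⟨φ, w, h1, h2, h3, h4⟩ := hu (ε / (‖c‖ + 1)) (div_pos hε hc)
    refine ⟨c • φ, c • w, contDiff_const.smul h1, ?_, ?_, ?_⟩
    · exact (Lp.coeFn_smul c (H1.toL2 Ω w)).trans (h2.const_smul c)
    · rw [← smul_sub, norm_smul]
      calc ‖c‖ * ‖w - u‖ ≤ (‖c‖ + 1) * ‖w - u‖ := by gcongr; linarith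
        _ < (‖c‖ + 1) * (ε / (‖c‖ + 1)) := by gcongr
        _ = ε := by field_simp
    · have e : (fun η => (c • φ) η - (0 : E n → ℝ) η) =
          c • (fun η => φ η - (0 : E n → ℝ) η) := by
        funext η; simp
      rw [e]
      refine (eLpNorm_const_smul_le).trans_lt ?_
      calc ‖c‖ₑ * _ ≤ ENNReal.ofReal (‖c‖ + 1) * eLpNorm (fun η => φ η - (0 : E n → ℝ) η) 2
              ((surf n).restrict Γ) := by
            gcongr
            rw [← ofReal_norm]
            exact ENNReal.ofReal_le_ofReal (by linarith)
        _ < ENNReal.ofReal (‖c‖ + 1) * ENNReal.ofReal (ε / (‖c‖ + 1)) :=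
            ENNReal.mul_lt_mul_right (by simpa using hc) ENNReal.ofReal_ne_top h4
        _ = ENNReal.ofReal ε := by
            rw [← ENNReal.ofReal_mul hc.le]; congr 1; field_simp

instance isClosed_traceKer {n : ℕ} (Ω Γ : Set (E n)) :
    IsClosed (traceKer Ω Γ : Set (H1 Ω)) := by
  refine isClosed_of_closure_subset fun u hu ε hε => ?_
  obtain ⟨v, hv, hd⟩ := Metric.mem_closure_iff.1 hu (ε / 2) (half_pos hε)
  obtain ⟨φ, w, h1, h2, h3, h4⟩ := (hv : IsTrace Ω Γ v 0) (ε / 2) (half_pos hε)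
  refine ⟨φ, w, h1, h2, ?_, h4.trans_le (ENNReal.ofReal_le_ofReal (by linarith))⟩
  rw [dist_comm, dist_eq_norm] at hd
  calc ‖w - u‖ = ‖(w - v) + (v - u)‖ := by congr 1; abel
    _ ≤ ‖w - v‖ + ‖v - u‖ := norm_add_le _ _
    _ < ε := by linarith

theorem traceKer_anti {n : ℕ} (Ω : Set (E n)) {Γ Γ' : Set (E n)} (h : Γ ⊆ Γ') :
    traceKer Ω Γ' ≤ traceKer Ω Γ := by
  intro u hu ε hε
  obtain ⟨φ, w, h1, h2, h3, h4⟩ := (hu : IsTrace Ω Γ' u 0) ε hε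
  exact ⟨φ, w, h1, h2, h3, (eLpNorm_mono_measure _ (Measure.restrict_mono_set _ h)).trans_lt h4⟩

/-- The trace space `H^{1/2}(Γ)` of traces on `Γ` of functions of `H¹(Ω)`: two such functions give
the same element if and only if they have the same trace on `Γ`, and the norm is the quotient norm
`‖g‖ = inf {‖u‖_{H¹(Ω)} : the trace of u on Γ is g}`. For `Γ = ∂Ω` it is `H^{1/2}(∂Ω)`. -/
def HHalf {n : ℕ} (Ω Γ : Set (E n)) : Type := H1 Ω ⧸ traceKer Ω Γ

instance {n : ℕ} (Ω Γ : Set (E n)) : CompleteSpace (traceKer Ω Γ) :=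
  (isClosed_traceKer Ω Γ).completeSpace_coe

instance {n : ℕ} (Ω Γ : Set (E n)) : NormedAddCommGroup (HHalf Ω Γ) :=
  inferInstanceAs (NormedAddCommGroup (H1 Ω ⧸ traceKer Ω Γ))

instance {n : ℕ} (Ω Γ : Set (E n)) : NormedSpace ℝ (HHalf Ω Γ) :=
  inferInstanceAs (NormedSpace ℝ (H1 Ω ⧸ traceKer Ω Γ))

instance {n : ℕ} (Ω Γ : Set (E n)) : CompleteSpace (HHalf Ω Γ) :=
  inferInstanceAs (CompleteSpace (H1 Ω ⧸ traceKer Ω Γ))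

/-- The trace on `Γ` of a function of `H¹(Ω)`, as an element of `H^{1/2}(Γ)`. -/
def HHalf.tr {n : ℕ} (Ω Γ : Set (E n)) : H1 Ω →L[ℝ] HHalf Ω Γ :=
  (traceKer Ω Γ).mkQL

theorem HHalf.tr_eq_zero_iff {n : ℕ} {Ω Γ : Set (E n)} {u : H1 Ω} :
    HHalf.tr Ω Γ u = 0 ↔ IsTrace Ω Γ u 0 :=
  Submodule.Quotient.mk_eq_zero (traceKer Ω Γ)

/-- The isometry of `H^{1/2}(Γ)` with the orthogonal complement of the kernel of the trace. -/
def HHalf.equivOrth {n : ℕ} (Ω Γ : Set (E n)) : HHalf Ω Γ ≃ₗᵢ[ℝ] (traceKer Ω Γ)ᗮ :=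
  (traceKer Ω Γ).quotientEquivOrthogonal

/-- The inner product that induces the quotient norm of `H^{1/2}(Γ)`. -/
instance {n : ℕ} (Ω Γ : Set (E n)) : InnerProductSpace ℝ (HHalf Ω Γ) where
  inner x y := ⟪HHalf.equivOrth Ω Γ x, HHalf.equivOrth Ω Γ y⟫_ℝ
  norm_sq_eq_re_inner x := by
    rw [← (HHalf.equivOrth Ω Γ).norm_map x]
    exact norm_sq_eq_re_inner (𝕜 := ℝ) _
  conj_inner_symm x y := inner_conj_symm _ _
  add_left x y z := by
    rw [map_add, inner_add_left]
  smul_left x y r := by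
    rw [map_smul, inner_smul_left]

/-- The Hilbert space `(H^{1/2}(Γ))ⁿ`. -/
abbrev HHalfVec {n : ℕ} (Ω Γ : Set (E n)) := PiLp 2 (fun _ : Fin n => HHalf Ω Γ)

/-- The trace operator of order zero `γ₀ : H¹(Ω) → H^{1/2}(∂Ω)`. -/
def trace0 {n : ℕ} (Ω : Set (E n)) : H1 Ω →L[ℝ] HHalf Ω (frontier Ω) :=
  HHalf.tr Ω (frontier Ω)

/-- The restriction operator from `H^{1/2}(∂Ω)` to `H^{1/2}(Γ)`, for `Γ ⊆ ∂Ω`. -/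
def restr0 {n : ℕ} (Ω : Set (E n)) {Γ : Set (E n)} (hΓ : Γ ⊆ frontier Ω) :
    HHalf Ω (frontier Ω) →L[ℝ] HHalf Ω Γ :=
  (traceKer Ω (frontier Ω)).liftQL (HHalf.tr Ω Γ) fun _ hu =>
    HHalf.tr_eq_zero_iff.2 (traceKer_anti Ω hΓ hu)

theorem restr0_trace0 {n : ℕ} (Ω : Set (E n)) {Γ : Set (E n)} (hΓ : Γ ⊆ frontier Ω) (u : H1 Ω) :
    restr0 Ω hΓ (trace0 Ω u) = HHalf.tr Ω Γ u :=
  rfl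

/-- A bounded operator applied to each of the `n` components. -/
def comps {F G : Type*} [NormedAddCommGroup F] [NormedSpace ℝ F] [NormedAddCommGroup G]
    [NormedSpace ℝ G] (n : ℕ) (f : F →L[ℝ] G) :
    PiLp 2 (fun _ : Fin n => F) →L[ℝ] PiLp 2 (fun _ : Fin n => G) :=
  (PiLp.continuousLinearEquiv 2 ℝ (fun _ : Fin n => G)).symm.toContinuousLinearMap.comp
    (ContinuousLinearMap.pi fun i => f.comp (PiLp.proj (𝕜 := ℝ) 2 (fun _ : Fin n => F) i))

/-- The trace operator `γ : (H¹(Ω))ⁿ → (H^{1/2}(∂Ω))ⁿ`. -/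
def traceVec {n : ℕ} (Ω : Set (E n)) : H1Vec Ω →L[ℝ] HHalfVec Ω (frontier Ω) :=
  comps n (trace0 Ω)

/-- The restriction operator `χ_Γ : (H^{1/2}(∂Ω))ⁿ → (H^{1/2}(Γ))ⁿ`. -/
def restrVec {n : ℕ} (Ω : Set (E n)) {Γ : Set (E n)} (hΓ : Γ ⊆ frontier Ω) :
    HHalfVec Ω (frontier Ω) →L[ℝ] HHalfVec Ω Γ :=
  comps n (restr0 Ω hΓ)

/-! ### Strongly continuous semigroups -/

/-- A strongly continuous semigroup `(S(t))_{t ≥ 0}` of bounded operators on `X`. -/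
structure C0Semigroup (X : Type*) [NormedAddCommGroup X] [InnerProductSpace ℝ X] where
  S : ℝ≥0 → X →L[ℝ] X
  zero : S 0 = ContinuousLinearMap.id ℝ X
  add : ∀ s t, S (s + t) = (S s).comp (S t)
  cont : ∀ x, Continuous fun t => S t x

/-- `z = lim_{t → 0+} (S(t) x - x) / t`. -/
def C0Semigroup.HasGen {X : Type*} [NormedAddCommGroup X] [InnerProductSpace ℝ X]
    (S : C0Semigroup X) (x z : X) : Prop :=
  Tendsto (fun t : ℝ≥0 => (t : ℝ)⁻¹ • (S.S t x - x)) (𝓝[>] 0) (𝓝 z)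

/-- The infinitesimal generator, with its domain. -/
def C0Semigroup.generator {X : Type*} [NormedAddCommGroup X] [InnerProductSpace ℝ X]
    (S : C0Semigroup X) : X →ₗ.[ℝ] X where
  domain :=
    { carrier := {x | ∃ z, S.HasGen x z}
      zero_mem' := ⟨0, by simp [C0Semigroup.HasGen]⟩
      add_mem' := by
        rintro x y ⟨z, hz⟩ ⟨z', hz'⟩
        refine ⟨z + z', (Tendsto.add hz hz').congr fun t => ?_⟩
        rw [← smul_add, map_add]; congr 1; abel
      smul_mem' := by
        rintro c x ⟨z, hz⟩
        refine ⟨c • z, (Tendsto.const_smul hz c).congr fun t => ?_⟩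
        rw [map_smul, smul_comm, smul_sub] }
  toFun :=
    { toFun := fun x => x.2.choose
      map_add' := fun x y => by
        refine tendsto_nhds_unique (x + y).2.choose_spec
          ((Tendsto.add x.2.choose_spec y.2.choose_spec).congr fun t => ?_)
        rw [← smul_add, Submodule.coe_add, map_add]; congr 1; abel
      map_smul' := fun c x => by
        refine tendsto_nhds_unique (c • x).2.choose_spec
          ((Tendsto.const_smul x.2.choose_spec c).congr fun t => ?_)
        rw [Submodule.coe_smul, map_smul, smul_comm, smul_sub] }

/-- A partially defined operator has compact resolvent: for some real `l` the operator `l - G` has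
an everywhere defined compact inverse. -/
def HasCompactResolvent {X : Type*} [NormedAddCommGroup X] [InnerProductSpace ℝ X]
    (G : X →ₗ.[ℝ] X) : Prop :=
  ∃ (l : ℝ) (R : X →L[ℝ] X), IsCompactOperator R ∧
    (∀ x, ∃ h : R x ∈ G.domain, l • R x - G ⟨R x, h⟩ = x) ∧
    ∀ x : G.domain, R (l • (x : X) - G x) = x

/-! ### The observed system -/

/-- `z = A u` with `A u = ∑ᵢⱼ ∂/∂ξ_i (a_ij ∂u/∂ξ_j)`, in the weak sense, and `u = 0` on `∂Ω`. -/
def IsDirichletImage {n : ℕ} {Ω : Set (E n)} (a : Fin n → Fin n → E n → ℝ) (u z : L2 Ω) : Prop :=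
  ∃ w ∈ H10 Ω, H1.toL2 Ω w = u ∧ ∀ φ, IsTest Ω φ →
    ∫ ξ in Ω, ∑ i, ∑ j, a i j ξ * H1.partialL Ω j w ξ * pd i φ ξ = - ∫ ξ in Ω, z ξ * φ ξ

/-- The autonomous parabolic system `∂x/∂t = A x` in `Ω × (0, T)`, `x(0) = x₀`, `x = 0` on
`∂Ω × (0, T)`, with the output `y = C x`, on the Hilbert state space `X`. The states are functions
on `Ω`: the space `X` is continuously embedded in `L²(Ω)` by `fn`. The semigroup that solves the
system is generated by the realization of `A` in `X` with Dirichlet boundary condition. -/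
structure ObservedSystem {n : ℕ} (Ω : Set (E n)) (q : ℕ) (X : Type*) [NormedAddCommGroup X]
    [InnerProductSpace ℝ X] [CompleteSpace X] where
  a : Fin n → Fin n → E n → ℝ
  a_smooth : ∀ i j, ContDiff ℝ ∞ (a i j)
  elliptic : ∃ α : ℝ, 0 < α ∧ ∀ᵐ ξ ∂(volume.restrict Ω), ∀ ζ : Fin n → ℝ,
    α * ∑ j, |ζ j| ^ 2 ≤ ∑ i, ∑ j, a i j ξ * ζ i * ζ j
  fn : X →L[ℝ] L2 Ω
  fn_injective : Function.Injective fn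
  S : C0Semigroup X
  generated : ∀ x z : X, S.HasGen x z ↔ IsDirichletImage a (fn x) (fn z)
  selfAdjoint : IsSelfAdjoint S.generator
  compactResolvent : HasCompactResolvent S.generator
  C : X →L[ℝ] EuclideanSpace ℝ (Fin q)

/-- The observation space `O = L²(0, T; ℝ^q)`. -/
abbrev Obs (T : ℝ) (q : ℕ) := Lp (EuclideanSpace ℝ (Fin q)) 2 (volume.restrict (Ioo 0 T))

namespace ObservedSystem

variable {n : ℕ} {Ω : Set (E n)} {q : ℕ} {X : Type*} [NormedAddCommGroup X]
  [InnerProductSpace ℝ X] [CompleteSpace X]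

/-- The output `t ↦ C S(t) x`. -/
def output (sys : ObservedSystem Ω q X) (x : X) (t : ℝ) : EuclideanSpace ℝ (Fin q) :=
  sys.C (sys.S.S t.toNNReal x)

theorem output_bound (sys : ObservedSystem Ω q X) (T : ℝ) :
    ∃ M, 0 ≤ M ∧ ∀ x, ∀ t ∈ Ioo 0 T, ‖sys.output x t‖ ≤ M * ‖x‖ := by
  obtain ⟨M, hM⟩ := banach_steinhaus (g := fun t : Icc (0 : ℝ≥0) T.toNNReal => sys.S.S t) (by
    intro x
    obtain ⟨B, hB⟩ := isCompact_Icc.exists_bound_of_continuousOn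
      (sys.S.cont x).continuousOn (s := Icc (0 : ℝ≥0) T.toNNReal)
    exact ⟨B, fun t => hB t t.2⟩)
  refine ⟨‖sys.C‖ * |M|, by positivity, fun x t ht => ?_⟩
  have hm := hM ⟨t.toNNReal, zero_le, Real.toNNReal_le_toNNReal ht.2.le⟩
  calc ‖sys.output x t‖ ≤ ‖sys.C‖ * (‖sys.S.S t.toNNReal‖ * ‖x‖) :=
        (sys.C.le_opNorm _).trans (by gcongr; exact ContinuousLinearMap.le_opNorm _ _)
    _ ≤ ‖sys.C‖ * (|M| * ‖x‖) := by gcongr; exact hm.trans (le_abs_self M)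
    _ = _ := by ring

theorem output_memLp (sys : ObservedSystem Ω q X) (T : ℝ) (x : X) :
    MemLp (sys.output x) 2 (volume.restrict (Ioo 0 T)) := by
  obtain ⟨M, -, hM⟩ := sys.output_bound T
  have hc : Continuous (sys.output x) :=
    sys.C.continuous.comp ((sys.S.cont x).comp continuous_real_toNNReal)
  refine MemLp.of_bound hc.aestronglyMeasurable (M * ‖x‖) ?_
  exact (ae_restrict_iff' measurableSet_Ioo).2 (Eventually.of_forall (hM x))

/-- The operator `K : X → O`, `K x = C S(·) x`. -/
def K (sys : ObservedSystem Ω q X) (T : ℝ) : X →L[ℝ] Obs T q :=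
  LinearMap.mkContinuousOfExistsBound
    { toFun := fun x => (sys.output_memLp T x).toLp _
      map_add' := fun x y => by
        rw [← MemLp.toLp_add]
        congr 1
        funext t
        simp [output]
      map_smul' := fun c x => by
        rw [RingHom.id_apply, ← MemLp.toLp_const_smul]
        congr 1
        funext t
        simp [output] }
    (by
      obtain ⟨M, h0, hM⟩ := sys.output_bound T
      refine ⟨((volume.restrict (Ioo 0 T)).real univ) ^ (2 : ℝ≥0∞).toReal⁻¹ * M, fun x => ?_⟩
      rw [mul_assoc]
      refine Lp.norm_le_of_ae_bound (by positivity) ?_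
      filter_upwards [(sys.output_memLp T x).coeFn_toLp,
        ae_restrict_mem measurableSet_Ioo] with t h1 h2
      change ‖((sys.output_memLp T x).toLp _ : Obs T q) t‖ ≤ _
      rw [h1]
      exact hM x t h2)

/-- `∇ K^*` takes its values in `(H¹(Ω))ⁿ`: for every `y ∈ O` the function `K^* y` is in `H²(Ω)`.
This is what is needed for `χ_Γ γ ∇ K^*` to be defined on `O`. -/
def AdjointRegular (sys : ObservedSystem Ω q X) (T : ℝ) : Prop :=
  ∀ y : Obs T q, sys.fn ((sys.K T).adjoint y) ∈ range (H2.toL2 Ω)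

/-- The adjoint `K^*`, as an operator from `O` into `H²(Ω)`. It is bounded by the closed graph
theorem. -/
def Kstar (sys : ObservedSystem Ω q X) {T : ℝ} (hΩ : IsOpen Ω) (h : sys.AdjointRegular T) :
    Obs T q →L[ℝ] H2 Ω :=
  ContinuousLinearMap.ofSeqClosedGraph
    (g := (LinearEquiv.ofInjective (H2.toL2 Ω).toLinearMap (H2.toL2_injective hΩ)).symm.toLinearMap
      ∘ₗ LinearMap.codRestrict _ (sys.fn ∘L (sys.K T).adjoint).toLinearMap h)
    (by
      intro u y v hu hv
      have key : ∀ y, H2.toL2 Ω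
          (((LinearEquiv.ofInjective (H2.toL2 Ω).toLinearMap
            (H2.toL2_injective hΩ)).symm.toLinearMap
            ∘ₗ LinearMap.codRestrict _ (sys.fn ∘L (sys.K T).adjoint).toLinearMap h) y)
          = sys.fn ((sys.K T).adjoint y) := fun y =>
        congrArg Subtype.val ((LinearEquiv.ofInjective (H2.toL2 Ω).toLinearMap
          (H2.toL2_injective hΩ)).apply_symm_apply ⟨_, h y⟩)
      apply H2.toL2_injective hΩ
      rw [key]
      refine tendsto_nhds_unique (((H2.toL2 Ω).continuous.tendsto v).comp hv) ?_
      refine (((sys.fn ∘L (sys.K T).adjoint).continuous.tendsto y).comp hu).congr fun k => ?_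
      exact (key (u k)).symm)

theorem toL2_Kstar (sys : ObservedSystem Ω q X) {T : ℝ} (hΩ : IsOpen Ω)
    (h : sys.AdjointRegular T) (y : Obs T q) :
    H2.toL2 Ω (sys.Kstar hΩ h y) = sys.fn ((sys.K T).adjoint y) :=
  congrArg Subtype.val ((LinearEquiv.ofInjective (H2.toL2 Ω).toLinearMap
    (H2.toL2_injective hΩ)).apply_symm_apply ⟨_, h y⟩)

/-- The operator `K` on the domain `H²(Ω)` of the gradient, in duality with
`K^* : O → H²(Ω)`. -/
def Kext (sys : ObservedSystem Ω q X) {T : ℝ} (hΩ : IsOpen Ω) (h : sys.AdjointRegular T) :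
    H2 Ω →L[ℝ] Obs T q :=
  (sys.Kstar hΩ h).adjoint

/-- `Kext` agrees with `K`: an element `v` of `H²(Ω)` and a state `x` that define the same
functional on the states in `H²(Ω)` (by the inner product of `H²(Ω)` and of `X` respectively) have
the same image. -/
theorem Kext_eq_K (sys : ObservedSystem Ω q X) {T : ℝ} (hΩ : IsOpen Ω) (h : sys.AdjointRegular T)
    (v : H2 Ω) (x : X)
    (hvx : ∀ (w : H2 Ω) (x' : X), H2.toL2 Ω w = sys.fn x' → ⟪v, w⟫_ℝ = ⟪x, x'⟫_ℝ) :
    sys.Kext hΩ h v = sys.K T x := by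
  refine ext_inner_right ℝ fun y => ?_
  rw [Kext, ContinuousLinearMap.adjoint_inner_left, ← ContinuousLinearMap.adjoint_inner_right]
  exact hvx _ _ (sys.toL2_Kstar hΩ h y)

/-- If all states are in `H²(Ω)`, through a bounded embedding `j : X → H²(Ω)`, then
`K ∇^*` is literally the composition of `K` with the adjoint of the gradient `∇ : X → (H¹(Ω))ⁿ`. -/
theorem Kext_grad_adjoint (sys : ObservedSystem Ω q X) {T : ℝ} (hΩ : IsOpen Ω)
    (h : sys.AdjointRegular T) (j : X →L[ℝ] H2 Ω) (hj : ∀ x, H2.toL2 Ω (j x) = sys.fn x) :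
    sys.Kext hΩ h ∘L (grad Ω).adjoint = sys.K T ∘L (grad Ω ∘L j).adjoint := by
  ext1 f
  refine sys.Kext_eq_K hΩ h _ _ fun w x' hw => ?_
  have : w = j x' := H2.toL2_injective hΩ (by rw [hw, hj])
  rw [this]
  exact (ContinuousLinearMap.adjoint_inner_left (grad Ω) (j x') f).trans
    (ContinuousLinearMap.adjoint_inner_left (grad Ω ∘L j) x' f).symm

/-- The operator `H = χ_Γ γ ∇ K^*` from `O` into `(H^{1/2}(Γ))ⁿ`. -/
def Hop (sys : ObservedSystem Ω q X) {T : ℝ} (hΩ : IsOpen Ω) (h : sys.AdjointRegular T)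
    {Γ : Set (E n)} (hΓ : Γ ⊆ frontier Ω) : Obs T q →L[ℝ] HHalfVec Ω Γ :=
  restrVec Ω hΓ ∘L traceVec Ω ∘L grad Ω ∘L sys.Kstar hΩ h

/-- The system is exactly regionally boundary gradient observable on `Γ`: the image of
`H = χ_Γ γ ∇ K^*` is `(H^{1/2}(Γ))ⁿ`. -/
def ExactlyGradObservable (sys : ObservedSystem Ω q X) {T : ℝ} (hΩ : IsOpen Ω)
    (h : sys.AdjointRegular T) {Γ : Set (E n)} (hΓ : Γ ⊆ frontier Ω) : Prop :=
  range (sys.Hop hΩ h hΓ) = univ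

end ObservedSystem

end GradObs

end

/-!
The operator `K ∇^* γ^* χ_Γ^*` is the Hilbert space adjoint of `H = χ_Γ γ ∇ K^*`, because the
extension of `K` to `H²(Ω)` is by definition the adjoint of `K^* : O → H²(Ω)`. The equivalence is
therefore the duality between surjectivity of a bounded operator of Hilbert spaces and
boundedness from below of its adjoint
(`ContinuousLinearMap.surjective_iff_exists_norm_le_mul_norm_adjoint`).

If `A` is surjective, the open mapping theorem provides preimages `A u = x` with `‖u‖ ≤ c ‖x‖`, and
`‖x‖² = ⟪u, A† x⟫` gives the estimate. Conversely, the estimate says that the bilinear form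
`⟪A† x, A† y⟫` is coercive, so that by the Lax–Milgram theorem the operator `A A†` that represents
it is onto, and with it `A`.
-/

/-- A bounded operator between real Hilbert spaces is surjective if and only if its adjoint is
bounded below. -/
theorem ContinuousLinearMap.surjective_iff_exists_norm_le_mul_norm_adjoint {U V : Type*}
    [NormedAddCommGroup U] [InnerProductSpace ℝ U] [CompleteSpace U]
    [NormedAddCommGroup V] [InnerProductSpace ℝ V] [CompleteSpace V] (A : U →L[ℝ] V) :
    Function.Surjective A ↔ ∃ c : ℝ, 0 < c ∧ ∀ x, ‖x‖ ≤ c * ‖A.adjoint x‖ := by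
  constructor
  · intro hA
    obtain ⟨c, hc, hpre⟩ := A.exists_preimage_norm_le hA
    refine ⟨c, hc, fun x => ?_⟩
    obtain ⟨u, hu, hux⟩ := hpre x
    rcases (norm_nonneg x).eq_or_lt with h0 | h0
    · rw [← h0]
      positivity
    · refine le_of_mul_le_mul_left ?_ h0
      calc ‖x‖ * ‖x‖ = ⟪A u, x⟫_ℝ := by rw [hu, real_inner_self_eq_norm_mul_norm]
        _ = ⟪u, A.adjoint x⟫_ℝ := (A.adjoint_inner_right u x).symm
        _ ≤ ‖u‖ * ‖A.adjoint x‖ := real_inner_le_norm _ _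
        _ ≤ c * ‖x‖ * ‖A.adjoint x‖ := by gcongr
        _ = ‖x‖ * (c * ‖A.adjoint x‖) := by ring
  · rintro ⟨c, hc, hbound⟩ x
    let B : V →L[ℝ] V →L[ℝ] ℝ := (innerSL ℝ).bilinearComp A.adjoint A.adjoint
    have hB : IsCoercive B := by
      refine ⟨(c ^ 2)⁻¹, by positivity, fun y => ?_⟩
      have hBy : B y y = ‖A.adjoint y‖ * ‖A.adjoint y‖ := real_inner_self_eq_norm_mul_norm _
      rw [hBy, mul_assoc, inv_mul_le_iff₀ (by positivity)]
      calc ‖y‖ * ‖y‖ ≤ c * ‖A.adjoint y‖ * (c * ‖A.adjoint y‖) := by gcongr <;> exact hbound y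
        _ = c ^ 2 * (‖A.adjoint y‖ * ‖A.adjoint y‖) := by ring
    obtain ⟨y, hy⟩ := hB.continuousLinearEquivOfBilin.surjective x
    refine ⟨A.adjoint y, ext_inner_right ℝ fun w => ?_⟩
    rw [← hy, hB.continuousLinearEquivOfBilin_apply, ← A.adjoint_inner_right]
    rfl

/-- This holds because `Kext` is the adjoint of `K^*` as an operator into `H²(Ω)`, not into `X`. -/
theorem GradObs.ObservedSystem.adjoint_Hop {n q : ℕ} {Ω Γ : Set (GradObs.E n)} {T : ℝ}
    {X : Type*} [NormedAddCommGroup X] [InnerProductSpace ℝ X] [CompleteSpace X]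
    (sys : GradObs.ObservedSystem Ω q X) (hΩ : IsOpen Ω) (hreg : sys.AdjointRegular T)
    (hΓ : Γ ⊆ frontier Ω) :
    (sys.Hop hΩ hreg hΓ).adjoint = sys.Kext hΩ hreg ∘L (GradObs.grad Ω).adjoint ∘L
      (GradObs.traceVec Ω).adjoint ∘L (GradObs.restrVec Ω hΓ).adjoint := by
  simp only [GradObs.ObservedSystem.Hop, GradObs.ObservedSystem.Kext,
    ContinuousLinearMap.adjoint_comp, ContinuousLinearMap.comp_assoc]

theorem proposition2p6 {n q : ℕ} {Ω Γ : Set (GradObs.E n)} {T : ℝ}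
    {X : Type*} [NormedAddCommGroup X] [InnerProductSpace ℝ X] [CompleteSpace X]
    (hΩ : IsOpen Ω) (hΩb : Bornology.IsBounded Ω) (hΩr : GradObs.HasLipschitzBoundary Ω)
    (hΓ : Γ ⊆ frontier Ω) (hΓm : MeasurableSet Γ) (hT : 0 < T)
    (sys : GradObs.ObservedSystem Ω q X) (hreg : sys.AdjointRegular T) :
    sys.ExactlyGradObservable hΩ hreg hΓ ↔
      ∃ c : ℝ, 0 < c ∧ ∀ x : GradObs.HHalfVec Ω Γ,
        ‖x‖ ≤ c * ‖(sys.Kext hΩ hreg ∘L (GradObs.grad Ω).adjoint ∘L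
          (GradObs.traceVec Ω).adjoint ∘L (GradObs.restrVec Ω hΓ).adjoint) x‖ := by
  rw [← sys.adjoint_Hop hΩ hreg hΓ,
    ← ContinuousLinearMap.surjective_iff_exists_norm_le_mul_norm_adjoint]
  exact Set.range_eq_univ
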